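/- Let $F$ be a graph. A graph $G$ on $n$ vertices is called weakly $F$-saturated if $G$ contains no (not necessarily induced) copy of $F$ and the edges of $K_n$ that are not in $G$ can be ordered as $e_1,\dots,e_m$ so that, for every $i\in\{1,\dots,m\}$, the graph $G\cup\{e_1,\dots,e_i\}$ contains a copy of $F$ that has $e_i$ among its edges. Let $\mathrm{wsat}(n,F)$ be the minimum number of edges of a weakly $F$-saturated graph on $n$ vertices, and let $K_{s,s}$ be the complete bipartite graph with both parts of size $s$. Theorem. For every integer $s>2$, there exist weakly $K_{s,s}$-saturated graphs on $2s+1$ vertices, and $$\mathrm{wsat}(2s+1,K_{s,s})=\binom{2s+1}{2}-(4s-4).$$ -/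

import Mathlib

/-- `G` is weakly `F`-saturated: `G` contains no copy of `F`, and the edges of the complement of `G`
can be ordered as `e 0, …, e (m - 1)`, each listed exactly once, so that for every `i` the graph
obtained from `G` by adding `e 0, …, e i` contains a copy of `F` having `e i` among its edges.
Copies are not required to be induced. -/
def IsWeaklySaturated {V W : Type*} (F : SimpleGraph W) (G : SimpleGraph V) : Prop :=
  F.Free G ∧
    ∃ (m : ℕ) (e : Fin m → Sym2 V),
      Function.Injective e ∧ Set.range e = Gᶜ.edgeSet ∧
        ∀ i : Fin m,
          ∃ f : SimpleGraph.Copy F (G ⊔ SimpleGraph.fromEdgeSet {x | ∃ j ≤ i, e j = x}),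
            e i ∈ f.toSubgraph.edgeSet

/-- The weak saturation number `wsat(n, F)`: the minimum number of edges of a weakly `F`-saturated
graph on `n` vertices. -/
noncomputable def wsat {W : Type*} (n : ℕ) (F : SimpleGraph W) : ℕ :=
  sInf {k : ℕ | ∃ G : SimpleGraph (Fin n), IsWeaklySaturated F G ∧ G.edgeSet.ncard = k}

/-! List the missing edges in the order in which they are added. A copy of K_{s,s} through the new
edge has parts S and T that leave out exactly one vertex u, the hinge, and no edge still missing
afterwards joins S to T. Weakly saturated graphs thus give peelable lists. Conversely, the
complement of a longest peelable list is K_{s,s}-free, since a copy would allow one more pair to be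
put in front. It remains to show that the longest peelable lists on 2s+1 vertices have 4s-4 pairs.

Upper bound. The tail of a peelable list splits along S ∪ {u} and T ∪ {u}, which share only u. By
induction a set X of at least two vertices spans at most 2|X|-3 pairs (`Peelable.edgesIn_bounds`).
Call the shortfall from this bound the deficit of X, and X tight if it is 0. For the whole vertex
set the bound is 4s-1, three too many. The three come from
`Peelable.edgesIn_add_lt_of_inter_singleton`: the two (s+1)-sets left after the first split have
joint deficit at least 3. To see this, look at the first pair inside one of them and its own split.
A set cut by a split has deficit at least 1 in the tail, and usually at least 2 if it misses the
hinge. The configurations where this is not enough are excluded by `Peelable.not_tight_pair`, by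
`Peelable.edgesIn_add_lt_of_disjoint` and, when the new hinge is the common vertex, by
`Peelable.not_star`.

Lower bound. Two disjoint tight blocks of sizes s-1 and s carry 4s-8 pairs, and the two vertices
left over allow four more. -/

/-- `Peelable s l`: the pairs in `l` can be removed from the head on, each of them being the only
pair of the remaining list that joins the two sides of some pair of disjoint `s`-sets. -/
inductive Peelable {V : Type*} [DecidableEq V] (s : ℕ) : List (Sym2 V) → Prop
  | nil : Peelable s []
  | cons {l : List (Sym2 V)} (S T : Finset V) (x y : V) (hl : Peelable s l)
      (hST : Disjoint S T) (hS : S.card = s) (hT : T.card = s)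
      (hcross : ∀ a ∈ S, ∀ b ∈ T, s(a, b) ∉ l) (hx : x ∈ S) (hy : y ∈ T) :
      Peelable s (s(x, y) :: l)

/-- The number of pairs of `l` inside `X`. -/
def edgesIn {V : Type*} [DecidableEq V] (l : List (Sym2 V)) (X : Finset V) : ℕ :=
  l.countP (fun z => decide (z ∈ X.sym2))

/-- `S` and `T` partition the vertices other than `u`, and no pair of `l` joins them. -/
structure Separates {V : Type*} (l : List (Sym2 V)) (S T : Finset V) (u : V) : Prop where
  disj : Disjoint S T
  notMem_left : u ∉ S
  notMem_right : u ∉ T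
  cover : ∀ a, a ∈ S ∨ a ∈ T ∨ a = u
  cross : ∀ a ∈ S, ∀ b ∈ T, s(a, b) ∉ l

theorem Separates.symm {V : Type*} {l : List (Sym2 V)} {S T : Finset V} {u : V}
    (h : Separates l S T u) : Separates l T S u where
  disj := h.disj.symm
  notMem_left := h.notMem_right
  notMem_right := h.notMem_left
  cover a := by have := h.cover a; tauto
  cross a ha b hb := by rw [Sym2.eq_swap]; exact h.cross b hb a ha

/-! ### Counting pairs and vertices across a separation -/

section Count

variable {V : Type*} [DecidableEq V] {l : List (Sym2 V)} {S T X Y : Finset V} {u v x y : V}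
  {s : ℕ}

theorem edgesIn_nil (X : Finset V) : edgesIn [] X = 0 := rfl

theorem edgesIn_cons_of_mem (hx : x ∈ X) (hy : y ∈ X) :
    edgesIn (s(x, y) :: l) X = edgesIn l X + 1 := by
  simp [edgesIn, hx, hy]

theorem edgesIn_cons_of_not_mem (h : ¬(x ∈ X ∧ y ∈ X)) :
    edgesIn (s(x, y) :: l) X = edgesIn l X := by
  simp [edgesIn, h]

theorem Separates.edgesIn_le_add (h : Separates l S T u) (X : Finset V) :
    edgesIn l X ≤ edgesIn l (X \ T) + edgesIn l (X \ S) := by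
  obtain ⟨hST, -, -, -, hcross⟩ := h
  unfold edgesIn
  induction l with
  | nil => simp
  | cons z l ih =>
    have ih := ih fun a ha b hb h => hcross a ha b hb (List.mem_cons_of_mem _ h)
    have hz : z ∈ X.sym2 → z ∈ (X \ T).sym2 ∨ z ∈ (X \ S).sym2 := by
      induction z using Sym2.ind with
      | _ a b =>
        have h1 := fun ha hb => hcross a ha b hb List.mem_cons_self
        have h2 := fun hb ha => hcross b hb a ha (by rw [Sym2.eq_swap]; exact List.mem_cons_self)
        have h3 : a ∈ S → a ∉ T := fun h => Finset.disjoint_left.1 hST h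
        have h4 : b ∈ S → b ∉ T := fun h => Finset.disjoint_left.1 hST h
        simp only [Finset.mk_mem_sym2_iff, Finset.mem_sdiff]
        tauto
    simp only [List.countP_cons, decide_eq_true_eq]
    split_ifs <;> first | omega | tauto

theorem edgesIn_univ [Fintype V] (l : List (Sym2 V)) : edgesIn l Finset.univ = l.length := by
  simp [edgesIn]

theorem Separates.card_of_mem (h : Separates l S T u) (hu : u ∈ X) :
    X.card = (X ∩ S).card + (X ∩ T).card + 1 ∧ (X \ T).card = (X ∩ S).card + 1 ∧
      (X \ S).card = (X ∩ T).card + 1 := by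
  obtain ⟨hST, huS, huT, hcov, -⟩ := h
  have h1 : X \ T = insert u (X ∩ S) := by
    ext a
    have : a ∈ S → a ∉ T := fun h => Finset.disjoint_left.1 hST h
    have := hcov a
    simp only [Finset.mem_sdiff, Finset.mem_insert, Finset.mem_inter]
    constructor
    · tauto
    · rintro (rfl | h) <;> tauto
  have h2 : (X \ T).card = (X ∩ S).card + 1 := by
    rw [h1, Finset.card_insert_of_notMem (by simp [huS])]
  have h3 := Finset.card_inter_add_card_sdiff X T
  have h4 := Finset.card_inter_add_card_sdiff X S
  omega

theorem Separates.card_of_notMem (h : Separates l S T u) (hu : u ∉ X) :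
    X.card = (X ∩ S).card + (X ∩ T).card ∧ (X \ T).card = (X ∩ S).card ∧
      (X \ S).card = (X ∩ T).card := by
  obtain ⟨hST, huS, huT, hcov, -⟩ := h
  have h1 : X \ T = X ∩ S := by
    ext a
    have : a ∈ S → a ∉ T := fun h => Finset.disjoint_left.1 hST h
    have := hcov a
    simp only [Finset.mem_sdiff, Finset.mem_inter]
    constructor
    · rintro ⟨h, h'⟩
      have : a ≠ u := by rintro rfl; exact hu h
      tauto
    · tauto
  have h2 : (X \ T).card = (X ∩ S).card := by rw [h1]
  have h3 := Finset.card_inter_add_card_sdiff X T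
  have h4 := Finset.card_inter_add_card_sdiff X S
  omega

theorem card_inter_add_of_cover [Fintype V] (hXY : Disjoint X Y) (hcov : X ∪ Y = Finset.univ)
    (S : Finset V) : (X ∩ S).card + (Y ∩ S).card = S.card := by
  rw [← Finset.card_union_of_disjoint
    (hXY.mono Finset.inter_subset_left Finset.inter_subset_left), ← Finset.union_inter_distrib_right,
    hcov, Finset.univ_inter]

theorem card_inter_add_of_cover_singleton [Fintype V] (hXY : X ∩ Y = {v})
    (hcov : X ∪ Y = Finset.univ) (S : Finset V) :
    (X ∩ S).card + (Y ∩ S).card = S.card + if v ∈ S then 1 else 0 := by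
  rw [← Finset.card_union_add_card_inter, ← Finset.union_inter_distrib_right,
    hcov, Finset.univ_inter, ← Finset.inter_inter_distrib_right, hXY]
  split_ifs with h <;> simp [h]

theorem exists_separates [Fintype V] (hV : Fintype.card V = 2 * s + 1) (hST : Disjoint S T)
    (hS : S.card = s) (hT : T.card = s) (hcross : ∀ a ∈ S, ∀ b ∈ T, s(a, b) ∉ l) :
    ∃ u, Separates l S T u := by
  have h : ((S ∪ T)ᶜ).card = 1 := by
    rw [Finset.card_compl, Finset.card_union_of_disjoint hST]; omega
  obtain ⟨u, hu⟩ := Finset.card_eq_one.1 h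
  have key : ∀ a, (a ∉ S ∧ a ∉ T) ↔ a = u := fun a => by
    rw [← Finset.mem_singleton, ← hu]; simp
  refine ⟨u, hST, ((key u).2 rfl).1, ((key u).2 rfl).2, fun a => ?_, hcross⟩
  have := key a
  tauto

end Count

/-! ### Sparsity bounds and deficits of disjoint sets -/

section Sparse

variable {V : Type*} [DecidableEq V] [Fintype V] {l : List (Sym2 V)} {S T X : Finset V} {u : V}
  {s : ℕ}

/-- If the head lies in X, its separation cuts X into two nonempty parts overlapping at most in u.
The bounds for the parts add up to at most 2(|X|+1)-6, which leaves room for the head. -/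
theorem Peelable.edgesIn_bounds (hV : Fintype.card V = 2 * s + 1) (hl : Peelable s l)
    (X : Finset V) :
    (X.card ≤ 1 → edgesIn l X = 0) ∧ (2 ≤ X.card → edgesIn l X + 3 ≤ 2 * X.card) := by
  induction hl generalizing X with
  | nil => exact ⟨fun _ => rfl, fun h => by rw [edgesIn_nil]; omega⟩
  | @cons l S T x y hl hST hS hT hcross hx hy ih =>
    by_cases hz : x ∈ X ∧ y ∈ X
    · rw [edgesIn_cons_of_mem hz.1 hz.2]
      obtain ⟨u, sep⟩ := exists_separates hV hST hS hT hcross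
      have h := sep.edgesIn_le_add X
      have ha : 0 < (X ∩ S).card := Finset.card_pos.2 ⟨x, by simp [hz, hx]⟩
      have hb : 0 < (X ∩ T).card := Finset.card_pos.2 ⟨y, by simp [hz, hy]⟩
      have i1 := ih (X \ T)
      have i2 := ih (X \ S)
      by_cases hu : u ∈ X
      · have := sep.card_of_mem hu
        omega
      · have := sep.card_of_notMem hu
        omega
    · rw [edgesIn_cons_of_not_mem hz]
      exact ih X

theorem Peelable.edgesIn_add_four_le (hV : Fintype.card V = 2 * s + 1) (hl : Peelable s l)
    (sep : Separates l S T u) (hu : u ∈ X) (ha : 0 < (X ∩ S).card) (hb : 0 < (X ∩ T).card) :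
    edgesIn l X + 4 ≤ 2 * X.card := by
  have h := sep.edgesIn_le_add X
  have i1 := (hl.edgesIn_bounds hV (X \ T)).2
  have i2 := (hl.edgesIn_bounds hV (X \ S)).2
  have := sep.card_of_mem hu
  omega

/-- Without the hinge the two parts are disjoint, and their bounds add up to 2|X|-6. One unit is
given back because a part may be a single vertex, which spans 0 pairs and not -1. -/
theorem Peelable.edgesIn_add_five_le (hV : Fintype.card V = 2 * s + 1) (hl : Peelable s l)
    (sep : Separates l S T u) (hu : u ∉ X) (ha : 0 < (X ∩ S).card) (hb : 0 < (X ∩ T).card)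
    (h3 : 3 ≤ X.card) : edgesIn l X + 5 ≤ 2 * X.card := by
  have h := sep.edgesIn_le_add X
  have i1 := hl.edgesIn_bounds hV (X \ T)
  have i2 := hl.edgesIn_bounds hV (X \ S)
  have := sep.card_of_notMem hu
  omega

theorem Peelable.edgesIn_add_six_le (hV : Fintype.card V = 2 * s + 1) (hl : Peelable s l)
    (sep : Separates l S T u) (hu : u ∉ X) (ha : 2 ≤ (X ∩ S).card) (hb : 2 ≤ (X ∩ T).card) :
    edgesIn l X + 6 ≤ 2 * X.card := by
  have h := sep.edgesIn_le_add X
  have i1 := (hl.edgesIn_bounds hV (X \ T)).2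
  have i2 := (hl.edgesIn_bounds hV (X \ S)).2
  have := sep.card_of_notMem hu
  omega

/-- There are no two disjoint tight sets of size `s`. -/
theorem Peelable.not_tight_pair (hs : 2 < s) (hV : Fintype.card V = 2 * s + 1)
    (hl : Peelable s l) (P Q : Finset V) (hPQ : Disjoint P Q) (hP : P.card = s) (hQ : Q.card = s)
    (hPe : 2 * s ≤ edgesIn l P + 3) (hQe : 2 * s ≤ edgesIn l Q + 3) : False := by
  induction hl generalizing P Q with
  | nil => simp only [edgesIn_nil] at *; omega
  | @cons l S T x y hl hST hS hT hcross hx hy ih =>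
    obtain ⟨u, sep⟩ := exists_separates hV hST hS hT hcross
    have key : ∀ P Q : Finset V, Disjoint P Q → P.card = s → Q.card = s →
        2 * s ≤ edgesIn (s(x, y) :: l) P + 3 → 2 * s ≤ edgesIn (s(x, y) :: l) Q + 3 →
        x ∈ P → y ∈ P → False := by
      intro P Q hPQ hP hQ hPe hQe hxP hyP
      rw [edgesIn_cons_of_mem hxP hyP] at hPe
      have hxQ := Finset.disjoint_left.1 hPQ hxP
      have hyQ := Finset.disjoint_left.1 hPQ hyP
      rw [edgesIn_cons_of_not_mem (by tauto)] at hQe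
      have ha : 0 < (P ∩ S).card := Finset.card_pos.2 ⟨x, by simp [hxP, hx]⟩
      have hb : 0 < (P ∩ T).card := Finset.card_pos.2 ⟨y, by simp [hyP, hy]⟩
      -- Removing the head costs P only one pair, but a cut missing the hinge would force deficit 2.
      have huP : u ∈ P := by
        by_contra hu
        have := hl.edgesIn_add_five_le hV sep hu ha hb (by omega)
        omega
      have huQ := Finset.disjoint_left.1 hPQ huP
      have hc := sep.card_of_notMem huQ
      -- Q has s vertices, all in S ∪ T, and lacks both x and y. It can fill neither side, so it
      -- meets both and is not tight.
      have hSQ : (Q ∩ S).card < S.card := by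
        apply Finset.card_lt_card
        refine ⟨Finset.inter_subset_right, fun h => hxQ (Finset.mem_inter.1 (h hx)).1⟩
      have hTQ : (Q ∩ T).card < T.card := by
        apply Finset.card_lt_card
        refine ⟨Finset.inter_subset_right, fun h => hyQ (Finset.mem_inter.1 (h hy)).1⟩
      have := hl.edgesIn_add_five_le hV sep huQ (by omega) (by omega) (by omega)
      omega
    by_cases h1 : x ∈ P ∧ y ∈ P
    · exact key P Q hPQ hP hQ hPe hQe h1.1 h1.2
    by_cases h2 : x ∈ Q ∧ y ∈ Q
    · exact key Q P hPQ.symm hQ hP hQe hPe h2.1 h2.2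
    rw [edgesIn_cons_of_not_mem h1] at hPe
    rw [edgesIn_cons_of_not_mem h2] at hQe
    exact ih P Q hPQ hP hQ hPe hQe

/-- Disjoint sets of sizes `s` and `s + 1` are together at least two edges away from tight. -/
theorem Peelable.edgesIn_add_lt_of_disjoint (hs : 2 < s) (hV : Fintype.card V = 2 * s + 1)
    (hl : Peelable s l) (A C : Finset V) (hAC : Disjoint A C) (hA : A.card = s)
    (hC : C.card = s + 1) : edgesIn l A + edgesIn l C + 5 < 4 * s := by
  have hcovAC : A ∪ C = Finset.univ := by
    rw [← Finset.card_eq_iff_eq_univ, Finset.card_union_of_disjoint hAC]; omega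
  induction hl with
  | nil => simp only [edgesIn_nil]; omega
  | @cons l S T x y hl hST hS hT hcross hx hy ih =>
    by_contra hcon
    obtain ⟨u, sep⟩ := exists_separates hV hST hS hT hcross
    have cS := card_inter_add_of_cover hAC hcovAC S
    have cT := card_inter_add_of_cover hAC hcovAC T
    have huAC : u ∈ A ∨ u ∈ C := by
      rw [← Finset.mem_union, hcovAC]; exact Finset.mem_univ _
    -- The case where A lies on one side of the cut, up to u. All but one vertex of C is then on the
    -- other side, and those s vertices and A would be two disjoint tight sets.
    have key : ∀ S T : Finset V, Separates l S T u → u ∉ C →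
        (C ∩ S).card = s → (C ∩ T).card = 1 → 4 * s ≤ edgesIn l A + edgesIn l C + 6 → False := by
      intro S T sep huC hCS hCT he
      have h1 := sep.edgesIn_le_add C
      have h2 := sep.card_of_notMem huC
      have h3 := (hl.edgesIn_bounds hV (C \ S)).1 (by omega)
      have h4 := (hl.edgesIn_bounds hV (C \ T)).2 (by omega)
      have h5 := (hl.edgesIn_bounds hV A).2 (by omega)
      exact hl.not_tight_pair hs hV A (C \ T) (hAC.mono_right Finset.sdiff_subset) hA
        (by omega) (by omega) (by omega)
    by_cases h1 : x ∈ A ∧ y ∈ A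
    · have hxC := Finset.disjoint_left.1 hAC h1.1
      rw [edgesIn_cons_of_mem h1.1 h1.2, edgesIn_cons_of_not_mem (by tauto)] at hcon
      have ha : 0 < (A ∩ S).card := Finset.card_pos.2 ⟨x, by simp [h1, hx]⟩
      have hb : 0 < (A ∩ T).card := Finset.card_pos.2 ⟨y, by simp [h1, hy]⟩
      rcases huAC with hu | hu
      · have huC := Finset.disjoint_left.1 hAC hu
        have k1 := sep.card_of_mem hu
        have k2 := sep.card_of_notMem huC
        have := hl.edgesIn_add_five_le hV sep huC (by omega) (by omega) (by omega)
        have := hl.edgesIn_add_four_le hV sep hu ha hb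
        omega
      · have huA := Finset.disjoint_right.1 hAC hu
        have k1 := sep.card_of_mem hu
        have k2 := sep.card_of_notMem huA
        have := hl.edgesIn_add_four_le hV sep hu (by omega) (by omega)
        have := hl.edgesIn_add_five_le hV sep huA ha hb (by omega)
        omega
    by_cases h2 : x ∈ C ∧ y ∈ C
    · rw [edgesIn_cons_of_not_mem h1, edgesIn_cons_of_mem h2.1 h2.2] at hcon
      have ha : 0 < (C ∩ S).card := Finset.card_pos.2 ⟨x, by simp [h2, hx]⟩
      have hb : 0 < (C ∩ T).card := Finset.card_pos.2 ⟨y, by simp [h2, hy]⟩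
      rcases huAC with hu | hu
      · have huC := Finset.disjoint_left.1 hAC hu
        have k1 := sep.card_of_mem hu
        have k2 := sep.card_of_notMem huC
        have := hl.edgesIn_add_five_le hV sep huC ha hb (by omega)
        by_cases hA1 : 0 < (A ∩ S).card
        · by_cases hA2 : 0 < (A ∩ T).card
          · have := hl.edgesIn_add_four_le hV sep hu hA1 hA2
            omega
          · exact key T S sep.symm huC (by omega) (by omega) (by omega)
        · exact key S T sep huC (by omega) (by omega) (by omega)
      · have huA := Finset.disjoint_right.1 hAC hu
        have k1 := sep.card_of_mem hu
        have k2 := sep.card_of_notMem huA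
        have := hl.edgesIn_add_four_le hV sep hu ha hb
        have := hl.edgesIn_add_five_le hV sep huA (by omega) (by omega) (by omega)
        omega
    rw [edgesIn_cons_of_not_mem h1, edgesIn_cons_of_not_mem h2] at hcon
    exact hcon ih

end Sparse

/-! ### Families of almost tight sets through one vertex -/

section Star

variable {V : Type*} [DecidableEq V] [Fintype V] {l : List (Sym2 V)} {S T X : Finset V} {u : V}
  {s : ℕ}

theorem Finset.sum_le_sum_add_of_univ {ι : Type*} [Fintype ι] {f g : ι → ℕ} {k : ℕ}
    (h : ∀ i, g i ≤ f i) (hs : ∑ i, f i ≤ ∑ i, g i + k) (J : Finset ι) :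
    ∑ i ∈ J, f i ≤ ∑ i ∈ J, g i + k := by
  classical
  rw [← Finset.sum_add_sum_compl J f, ← Finset.sum_add_sum_compl J g] at hs
  have := Finset.sum_le_sum (s := Jᶜ) fun i _ => h i
  omega

/-- The edges at a vertex `v` in one of several almost tight sets that meet only in `v` can be
removed only with `v` as the vertex outside the separation. -/
theorem Peelable.not_separates_star {ι : Type*} [Fintype ι] [DecidableEq ι]
    (hs : 2 < s) (hV : Fintype.card V = 2 * s + 1) {x y v : V} (hl : Peelable s l)
    (sep : Separates l S T u) (hS : S.card = s) (hvT : v ∈ T)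
    (hxy : (x ∈ S ∧ y ∈ T) ∨ (y ∈ S ∧ x ∈ T)) (hl' : Peelable s (s(x, y) :: l))
    (P : ι → Finset V) (hP : ∀ i j, i ≠ j → Disjoint (P i) (P j)) (hv : ∀ i, v ∉ P i)
    (hcov : ∀ a, a ≠ v → ∃ i, a ∈ P i) (hcard : ∀ i, (P i).card < s)
    (hsum : ∑ i, (2 * (P i).card - 1) ≤ ∑ i, edgesIn (s(x, y) :: l) (insert v (P i)) + 1)
    (i : ι) (hx : x ∈ insert v (P i)) (hy : y ∈ insert v (P i)) : False := by
  have hvS : v ∉ S := Finset.disjoint_right.1 sep.disj hvT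
  have hvu : v ≠ u := by rintro rfl; exact sep.notMem_right hvT
  have hle : ∀ i, edgesIn (s(x, y) :: l) (insert v (P i)) ≤ 2 * (P i).card - 1 := by
    intro i
    have := hl'.edgesIn_bounds hV (insert v (P i))
    rw [Finset.card_insert_of_notMem (hv i)] at this
    omega
  -- All deficits are nonnegative, so any subfamily also has total deficit at most 1.
  have hJ := Finset.sum_le_sum_add_of_univ hle hsum
  obtain ⟨p, q, hpS, hqT, hp, hq, hpq⟩ : ∃ p q, p ∈ S ∧ q ∈ T ∧ p ∈ insert v (P i) ∧
      q ∈ insert v (P i) ∧ s(x, y) = s(p, q) := by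
    rcases hxy with h | h
    · exact ⟨x, y, h.1, h.2, hx, hy, rfl⟩
    · exact ⟨y, x, h.1, h.2, hy, hx, Sym2.eq_swap⟩
  have hpi : p ∈ P i := by
    rcases Finset.mem_insert.1 hp with rfl | h
    · exact absurd hpS hvS
    · exact h
  rw [hpq] at hJ
  have hcross : ∀ j, 0 < (P j ∩ S).card →
      0 < (insert v (P j) ∩ S).card ∧ 0 < (insert v (P j) ∩ T).card := by
    intro j hj
    refine ⟨hj.trans_le (Finset.card_le_card (Finset.inter_subset_inter_right
      (Finset.subset_insert _ _))), Finset.card_pos.2 ⟨v, by simp [hvT]⟩⟩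
  have hbound : ∀ j, 0 < (P j ∩ S).card →
      edgesIn l (insert v (P j)) + 2 ≤ 2 * (P j).card ∧
      (u ∉ P j → 2 ≤ (P j).card → edgesIn l (insert v (P j)) + 3 ≤ 2 * (P j).card) := by
    intro j hj
    have hc := Finset.card_insert_of_notMem (hv j)
    obtain ⟨c1, c2⟩ := hcross j hj
    by_cases hu : u ∈ P j
    · have := hl.edgesIn_add_four_le hV sep (Finset.mem_insert_of_mem hu) c1 c2
      exact ⟨by omega, fun h => absurd hu h⟩
    · have hu' : u ∉ insert v (P j) := by simp [hu, hvu.symm]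
      constructor
      · have h := sep.edgesIn_le_add (insert v (P j))
        have i1 := hl.edgesIn_bounds hV (insert v (P j) \ T)
        have i2 := hl.edgesIn_bounds hV (insert v (P j) \ S)
        have := sep.card_of_notMem hu'
        omega
      · intro _ h2
        have := hl.edgesIn_add_five_le hV sep hu' c1 c2 (by omega)
        omega
  have hother : ∀ j, j ≠ i → edgesIn (s(p, q) :: l) (insert v (P j)) =
      edgesIn l (insert v (P j)) := by
    intro j hj
    apply edgesIn_cons_of_not_mem
    rintro ⟨h, -⟩
    rcases Finset.mem_insert.1 h with rfl | h
    · exact hvS hpS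
    · exact Finset.disjoint_left.1 (hP j i hj) h hpi
  have hself := edgesIn_cons_of_mem (l := l) hp hq
  have hi0 : 0 < (P i ∩ S).card := Finset.card_pos.2 ⟨p, by simp [hpi, hpS]⟩
  -- A block has fewer than s vertices, so S reaches a second block.
  obtain ⟨w, hwS, hwi⟩ : ∃ w ∈ S, w ∉ P i := by
    by_contra! h
    have := Finset.card_le_card (show S ⊆ P i from h)
    have := hcard i
    omega
  obtain ⟨j, hwj⟩ := hcov w (by rintro rfl; exact hvS hwS)
  have hji : j ≠ i := by rintro rfl; exact hwi hwj
  have hj0 : 0 < (P j ∩ S).card := Finset.card_pos.2 ⟨w, by simp [hwj, hwS]⟩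
  -- Every block meeting S has deficit at least 1 in the tail, and the head repays only one unit, in
  -- block i. A third such block would exceed the allowance.
  have hSsub : S ⊆ (P i ∩ S) ∪ (P j ∩ S) := by
    intro a ha
    obtain ⟨k, hk⟩ := hcov a (by rintro rfl; exact hvS ha)
    by_cases hki : k = i
    · subst hki; simp [hk, ha]
    by_cases hkj : k = j
    · subst hkj; simp [hk, ha]
    exfalso
    have h3 := hJ {i, j, k}
    rw [Finset.sum_insert (by simp [Ne.symm hji, Ne.symm hki]),
      Finset.sum_insert (by simp [Ne.symm hkj]), Finset.sum_singleton,
      Finset.sum_insert (by simp [Ne.symm hji, Ne.symm hki]),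
      Finset.sum_insert (by simp [Ne.symm hkj]), Finset.sum_singleton,
      hother j hji, hother k hki, hself] at h3
    have b1 := (hbound i hi0).1
    have b2 := (hbound j hj0).1
    have b3 := (hbound k (Finset.card_pos.2 ⟨a, by simp [hk, ha]⟩)).1
    omega
  have hcS := (Finset.card_le_card hSsub).trans (Finset.card_union_le _ _)
  have h2 := hJ {i, j}
  rw [Finset.sum_insert (by simp [Ne.symm hji]), Finset.sum_singleton,
    Finset.sum_insert (by simp [Ne.symm hji]), Finset.sum_singleton, hother j hji, hself] at h2
  have b1 := hbound i hi0
  have b2 := hbound j hj0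
  have hci := hcard i
  have hcj := hcard j
  have hsub : ∀ k, (P k ∩ S).card ≤ (P k).card := fun k =>
    Finset.card_le_card Finset.inter_subset_left
  have hsub' : ∀ k, u ∈ P k → (P k ∩ S).card < (P k).card := fun k hk =>
    Finset.card_lt_card ⟨Finset.inter_subset_left, fun h =>
      sep.notMem_left (Finset.mem_inter.1 (h hk)).2⟩
  have s1 := hsub i
  have s2 := hsub j
  -- Blocks i and j may have joint deficit at most 2 in the tail, so it is enough that one of them
  -- misses u and has two vertices. If u is in one block and the other is a single vertex, the first
  -- contains s-1 vertices of S as well as u, too many. If u is in neither, s > 2 makes one of them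
  -- large enough.
  by_cases hui : u ∈ P i
  · have huj : u ∉ P j := Finset.disjoint_right.1 (hP j i hji) hui
    have := b2.2 huj
    have := hsub' i hui
    omega
  · have := b1.2 hui
    by_cases huj : u ∈ P j
    · have := hsub' j huj
      omega
    · have := b2.2 huj
      omega

/-- The family is allowed to vary so that induction on the list can refine it. A pair inside a block
can only be peeled with hinge v, and cutting every block along S and T then keeps the total deficit
at most 1. For an empty block the truncated `2 * 0 - 1 = 0` is the correct bound for the single
vertex v. -/
theorem Peelable.not_star (hs : 2 < s) (hV : Fintype.card V = 2 * s + 1) (hl : Peelable s l)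
    {ι : Type} [Fintype ι] (v : V)
    (P : ι → Finset V) (hP : ∀ i j, i ≠ j → Disjoint (P i) (P j)) (hv : ∀ i, v ∉ P i)
    (hcov : ∀ a, a ≠ v → ∃ i, a ∈ P i) (hcard : ∀ i, (P i).card < s)
    (hsum : ∑ i, (2 * (P i).card - 1) ≤ ∑ i, edgesIn l (insert v (P i)) + 1) : False := by
  classical
  induction hl generalizing ι with
  | nil =>
    have h1 : (Finset.univ.erase v).card ≤ ∑ i, (P i).card := by
      refine (Finset.card_le_card (t := Finset.univ.biUnion P) fun a ha => ?_).trans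
        Finset.card_biUnion_le
      simpa using hcov a (Finset.ne_of_mem_erase ha)
    rw [Finset.card_erase_of_mem (Finset.mem_univ v), Finset.card_univ, hV] at h1
    have h2 : ∑ i, (P i).card ≤ ∑ i, (2 * (P i).card - 1) :=
      Finset.sum_le_sum fun i _ => by omega
    simp only [edgesIn_nil, Finset.sum_const_zero] at hsum
    omega
  | @cons l S T x y hl hST hS hT hcross hx hy ih =>
    obtain ⟨u, sep⟩ := exists_separates hV hST hS hT hcross
    have hl' := Peelable.cons S T x y hl hST hS hT hcross hx hy
    by_cases hex : ∃ i, x ∈ insert v (P i) ∧ y ∈ insert v (P i)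
    · obtain ⟨i, hxi, hyi⟩ := hex
      rcases sep.cover v with hvS | hvT | rfl
      · exact hl.not_separates_star hs hV sep.symm hT hvS (Or.inr ⟨hy, hx⟩) hl' P hP hv hcov
          hcard hsum i hxi hyi
      · exact hl.not_separates_star hs hV sep hS hvT (Or.inl ⟨hx, hy⟩) hl' P hP hv hcov
          hcard hsum i hxi hyi
      · have hI : ∀ i (R R' : Finset V), Separates l R R' v →
            insert v (P i) \ R' = insert v (P i ∩ R) := by
          intro i R R' h
          ext a
          have h1 := h.cover a
          have h2 : a ∈ R → a ∉ R' := fun h' => Finset.disjoint_left.1 h.disj h'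
          have h3 := h.notMem_right
          simp only [Finset.mem_sdiff, Finset.mem_insert, Finset.mem_inter]
          constructor
          · tauto
          · rintro (rfl | h) <;> tauto
        -- Cutting a block into two nonempty parts lowers its bound by one. In the block of the head
        -- this offsets the lost pair, so no deficit grows.
        have hterm : ∀ i, edgesIn (s(x, y) :: l) (insert v (P i)) +
            ((2 * (P i ∩ S).card - 1) + (2 * (P i ∩ T).card - 1)) ≤
            (edgesIn l (insert v (P i ∩ S)) + edgesIn l (insert v (P i ∩ T))) +
              (2 * (P i).card - 1) := by
          intro i
          have h1 := sep.edgesIn_le_add (insert v (P i))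
          rw [hI i S T sep, hI i T S sep.symm] at h1
          have h2 := sep.card_of_notMem (hv i)
          by_cases hz : x ∈ insert v (P i) ∧ y ∈ insert v (P i)
          · rw [edgesIn_cons_of_mem hz.1 hz.2]
            have hxv : x ≠ v := by rintro rfl; exact sep.notMem_left hx
            have hyv : y ≠ v := by rintro rfl; exact sep.notMem_right hy
            have ha : 0 < (P i ∩ S).card :=
              Finset.card_pos.2 ⟨x, by simpa [hx, hxv] using hz.1⟩
            have hb : 0 < (P i ∩ T).card :=
              Finset.card_pos.2 ⟨y, by simpa [hy, hyv] using hz.2⟩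
            omega
          · rw [edgesIn_cons_of_not_mem hz]
            omega
        have hsum' := Finset.sum_le_sum (s := Finset.univ) fun i _ => hterm i
        simp only [Finset.sum_add_distrib] at hsum'
        refine ih (ι := ι ⊕ ι) (Sum.elim (fun i => P i ∩ S) fun i => P i ∩ T) ?_ ?_ ?_ ?_ ?_
        · rintro (i | i) (j | j) hij
          · exact (hP i j fun h => hij (by rw [h])).mono Finset.inter_subset_left
              Finset.inter_subset_left
          · exact hST.mono Finset.inter_subset_right Finset.inter_subset_right
          · exact hST.symm.mono Finset.inter_subset_right Finset.inter_subset_right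
          · exact (hP i j fun h => hij (by rw [h])).mono Finset.inter_subset_left
              Finset.inter_subset_left
        · rintro (i | i) <;> simp [hv i]
        · intro a ha
          obtain ⟨i, hi⟩ := hcov a ha
          rcases sep.cover a with h | h | h
          · exact ⟨Sum.inl i, by simp [hi, h]⟩
          · exact ⟨Sum.inr i, by simp [hi, h]⟩
          · exact absurd h ha
        · rintro (i | i) <;>
            exact (Finset.card_le_card Finset.inter_subset_left).trans_lt (hcard i)
        · simp only [Fintype.sum_sum_type, Sum.elim_inl, Sum.elim_inr]
          omega
    · refine ih P hP hv hcov hcard (hsum.trans_eq ?_)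
      congr 1
      refine Finset.sum_congr rfl fun i _ => edgesIn_cons_of_not_mem fun h => hex ⟨i, h⟩

end Star

/-! ### The upper bound 4s-4 -/

section Bound

variable {V : Type*} [DecidableEq V] [Fintype V] {l : List (Sym2 V)} {S T X : Finset V} {u : V}
  {s : ℕ}

/-- X and Y are cut at v into four nonempty blocks of fewer than s vertices. Their bounds add up to
4s-4, so `he` leaves total deficit at most 1, which `Peelable.not_star` forbids. -/
theorem Peelable.not_hinge_at_common_vertex (hs : 2 < s) (hV : Fintype.card V = 2 * s + 1)
    (hl : Peelable s l) {v : V} (sep : Separates l S T v) (hS : S.card = s) (hT : T.card = s)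
    (X Y : Finset V) (hXY : X ∩ Y = {v}) (hcov : X ∪ Y = Finset.univ) (hX : X.card = s + 1)
    (ha : 0 < (X ∩ S).card) (hb : 0 < (X ∩ T).card)
    (he : 4 * s ≤ edgesIn l X + edgesIn l Y + 5) : False := by
  have hvX : v ∈ X := Finset.inter_subset_left (hXY ▸ Finset.mem_singleton_self v)
  have hvY : v ∈ Y := Finset.inter_subset_right (hXY ▸ Finset.mem_singleton_self v)
  have hdisj : ∀ a, a ∈ X → a ∈ Y → a = v := fun a h h' => by
    rw [← Finset.mem_singleton, ← hXY]; exact Finset.mem_inter.2 ⟨h, h'⟩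
  have cS := card_inter_add_of_cover_singleton hXY hcov S
  have cT := card_inter_add_of_cover_singleton hXY hcov T
  rw [if_neg sep.notMem_left] at cS
  rw [if_neg sep.notMem_right] at cT
  have kX := sep.card_of_mem hvX
  have hI : ∀ (Z R R' : Finset V), v ∈ Z → Separates l R R' v →
      Z \ R' = insert v (Z ∩ R) := by
    intro Z R R' hZ h
    ext a
    have h1 := h.cover a
    have h2 : a ∈ R → a ∉ R' := fun h' => Finset.disjoint_left.1 h.disj h'
    have h3 := h.notMem_right
    simp only [Finset.mem_sdiff, Finset.mem_insert, Finset.mem_inter]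
    constructor
    · tauto
    · rintro (rfl | h) <;> tauto
  have eX := sep.edgesIn_le_add X
  have eY := sep.edgesIn_le_add Y
  rw [hI _ S T hvX sep, hI _ T S hvX sep.symm] at eX
  rw [hI _ S T hvY sep, hI _ T S hvY sep.symm] at eY
  have hd1 : ∀ Z Z' : Finset V, Disjoint (Z ∩ S) (Z' ∩ T) := fun Z Z' =>
    sep.disj.mono Finset.inter_subset_right Finset.inter_subset_right
  have hd2 : ∀ R : Finset V, v ∉ R → Disjoint (X ∩ R) (Y ∩ R) := by
    intro R hR
    rw [Finset.disjoint_left]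
    intro a h h'
    rw [Finset.mem_inter] at h h'
    exact hR (hdisj a h.1 h'.1 ▸ h.2)
  refine hl.not_star hs hV v (ι := Bool × Bool)
    (fun i => (if i.1 then X else Y) ∩ (if i.2 then S else T)) ?_ ?_ ?_ ?_ ?_
  · rintro ⟨_ | _, _ | _⟩ ⟨_ | _, _ | _⟩ hij <;> simp at hij ⊢
    all_goals first
      | exact hd1 _ _ | exact (hd1 _ _).symm | exact hd2 _ sep.notMem_left
      | exact (hd2 _ sep.notMem_left).symm | exact hd2 _ sep.notMem_right
      | exact (hd2 _ sep.notMem_right).symm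
  · rintro ⟨_ | _, _ | _⟩ <;> simp [sep.notMem_left, sep.notMem_right]
  · intro a hav
    have h1 : a ∈ X ∨ a ∈ Y := by rw [← Finset.mem_union, hcov]; exact Finset.mem_univ a
    have h2 := sep.cover a
    simp only [Prod.exists, Bool.exists_bool, Finset.mem_inter]
    simp only [Bool.false_eq_true, if_true, if_false]
    tauto
  · rintro ⟨_ | _, _ | _⟩ <;> simp <;> omega
  · simp only [Fintype.sum_prod_type, Fintype.sum_bool, Bool.false_eq_true, if_true, if_false]
    omega

/-- The joint deficit is at most 3 by `he`. When both sets are cut, the one with the hinge has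
deficit at least 1 and the other at least 2. Equality must hold, and it leaves a pair of disjoint
tight s-sets. -/
theorem Peelable.not_separates_common_vertex (hs : 2 < s) (hV : Fintype.card V = 2 * s + 1)
    (hl : Peelable s l) {v : V} (sep : Separates l S T u) (hS : S.card = s) (hT : T.card = s)
    (hvS : v ∈ S)
    (X Y : Finset V) (hXY : X ∩ Y = {v}) (hcov : X ∪ Y = Finset.univ) (hX : X.card = s + 1)
    (hY : Y.card = s + 1) (ha : 0 < (X ∩ S).card) (hb : 0 < (X ∩ T).card)
    (he : 4 * s ≤ edgesIn l X + edgesIn l Y + 5) : False := by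
  have hvX : v ∈ X := Finset.inter_subset_left (hXY ▸ Finset.mem_singleton_self v)
  have hvY : v ∈ Y := Finset.inter_subset_right (hXY ▸ Finset.mem_singleton_self v)
  have hdisj : ∀ a, a ∈ X → a ∈ Y → a = v := fun a h h' => by
    rw [← Finset.mem_singleton, ← hXY]; exact Finset.mem_inter.2 ⟨h, h'⟩
  have hvT : v ∉ T := Finset.disjoint_left.1 sep.disj hvS
  have huv : u ≠ v := by rintro rfl; exact sep.notMem_left hvS
  have cS := card_inter_add_of_cover_singleton hXY hcov S
  have cT := card_inter_add_of_cover_singleton hXY hcov T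
  rw [if_pos hvS] at cS
  rw [if_neg hvT] at cT
  have haY : 0 < (Y ∩ S).card := Finset.card_pos.2 ⟨v, by simp [hvY, hvS]⟩
  have huXY : u ∈ X ∨ u ∈ Y := by rw [← Finset.mem_union, hcov]; exact Finset.mem_univ u
  have eX := sep.edgesIn_le_add X
  have eY := sep.edgesIn_le_add Y
  have t1 := hl.edgesIn_bounds hV (X \ S)
  have t2 := hl.edgesIn_bounds hV (X \ T)
  have t3 := hl.edgesIn_bounds hV (Y \ S)
  have t4 := hl.edgesIn_bounds hV (Y \ T)
  by_cases huX : u ∈ X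
  · have huY : u ∉ Y := fun h => huv (hdisj u huX h)
    have kX := sep.card_of_mem huX
    have kY := sep.card_of_notMem huY
    have hd : Disjoint (X \ S) (Y \ T) := by
      rw [Finset.disjoint_left]
      intro a h h'
      rw [Finset.mem_sdiff] at h h'
      exact h.2 (hdisj a h.1 h'.1 ▸ hvS)
    have b1 := hl.edgesIn_add_four_le hV sep huX ha hb
    have b2 := hl.edgesIn_add_five_le hV sep huY haY (by omega) (by omega)
    have hbY : (Y ∩ T).card = 1 := by
      by_contra hne
      have := hl.edgesIn_add_six_le hV sep huY (by omega) (by omega)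
      omega
    exact hl.not_tight_pair hs hV _ _ hd (by omega) (by omega) (by omega) (by omega)
  · have huY : u ∈ Y := huXY.resolve_left huX
    have kX := sep.card_of_notMem huX
    have kY := sep.card_of_mem huY
    have b1 := hl.edgesIn_add_five_le hV sep huX ha hb (by omega)
    by_cases hbY : 0 < (Y ∩ T).card
    · have b2 := hl.edgesIn_add_four_le hV sep huY haY hbY
      have hbX : (X ∩ T).card = 1 := by
        by_contra hne
        have := hl.edgesIn_add_six_le hV sep huX (by omega) (by omega)
        omega
      have hd : Disjoint (X \ T) (Y \ S) := by
        rw [Finset.disjoint_left]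
        intro a h h'
        rw [Finset.mem_sdiff] at h h'
        exact h'.2 (hdisj a h.1 h'.1 ▸ hvS)
      exact hl.not_tight_pair hs hV _ _ hd (by omega) (by omega) (by omega) (by omega)
    -- Here T lies in X, so X has one vertex in S and all pairs in X lie in T. The sets T and Y are
    -- disjoint, of sizes s and s+1.
    · have hd : Disjoint (X \ S) Y := by
        rw [Finset.disjoint_left]
        intro a h h'
        rw [Finset.mem_sdiff] at h
        exact h.2 (hdisj a h.1 h' ▸ hvS)
      have := hl.edgesIn_add_lt_of_disjoint hs hV _ _ hd (by omega) hY
      omega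

/-- Two sets of size `s + 1` that cover everything and meet in one vertex are together at least
three edges away from tight. -/
theorem Peelable.edgesIn_add_lt_of_inter_singleton (hs : 2 < s)
    (hV : Fintype.card V = 2 * s + 1) (hl : Peelable s l) (v : V) (X Y : Finset V)
    (hXY : X ∩ Y = {v}) (hcov : X ∪ Y = Finset.univ) (hX : X.card = s + 1)
    (hY : Y.card = s + 1) : edgesIn l X + edgesIn l Y + 4 < 4 * s := by
  induction hl with
  | nil => simp only [edgesIn_nil]; omega
  | @cons l S T x y hl hST hS hT hcross hx hy ih =>
    by_contra hcon
    obtain ⟨u, sep⟩ := exists_separates hV hST hS hT hcross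
    have hxy : x ≠ y := by rintro rfl; exact Finset.disjoint_left.1 hST hx hy
    have key : ∀ X Y : Finset V, X ∩ Y = {v} → X ∪ Y = Finset.univ → X.card = s + 1 →
        Y.card = s + 1 → x ∈ X → y ∈ X →
        4 * s ≤ edgesIn (s(x, y) :: l) X + edgesIn (s(x, y) :: l) Y + 4 → False := by
      intro X Y hXY hcov hX hY hxX hyX he
      have hnot : ¬(x ∈ Y ∧ y ∈ Y) := by
        rintro ⟨hxY, hyY⟩
        have h1 : x ∈ X ∩ Y := Finset.mem_inter.2 ⟨hxX, hxY⟩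
        have h2 : y ∈ X ∩ Y := Finset.mem_inter.2 ⟨hyX, hyY⟩
        rw [hXY, Finset.mem_singleton] at h1 h2
        exact hxy (h1.trans h2.symm)
      rw [edgesIn_cons_of_mem hxX hyX, edgesIn_cons_of_not_mem hnot] at he
      have ha : 0 < (X ∩ S).card := Finset.card_pos.2 ⟨x, by simp [hxX, hx]⟩
      have hb : 0 < (X ∩ T).card := Finset.card_pos.2 ⟨y, by simp [hyX, hy]⟩
      rcases sep.cover v with h | h | rfl
      · exact hl.not_separates_common_vertex hs hV sep hS hT h X Y hXY hcov hX hY ha hb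
          (by omega)
      · exact hl.not_separates_common_vertex hs hV sep.symm hT hS h X Y hXY hcov hX hY hb ha
          (by omega)
      · exact hl.not_hinge_at_common_vertex hs hV sep hS hT X Y hXY hcov hX ha hb (by omega)
    by_cases h1 : x ∈ X ∧ y ∈ X
    · exact key X Y hXY hcov hX hY h1.1 h1.2 (by omega)
    by_cases h2 : x ∈ Y ∧ y ∈ Y
    · exact key Y X (by rw [Finset.inter_comm, hXY]) (by rw [Finset.union_comm, hcov]) hY hX
        h2.1 h2.2 (by omega)
    rw [edgesIn_cons_of_not_mem h1, edgesIn_cons_of_not_mem h2] at hcon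
    exact hcon ih

theorem Peelable.length_le (hs : 2 < s) (hV : Fintype.card V = 2 * s + 1) (hl : Peelable s l) :
    l.length ≤ 4 * s - 4 := by
  cases hl with
  | nil => simp
  | @cons l S T x y hl hST hS hT hcross hx hy =>
    obtain ⟨u, sep⟩ := exists_separates hV hST hS hT hcross
    have h := sep.edgesIn_le_add Finset.univ
    have hc := sep.card_of_mem (Finset.mem_univ u)
    rw [edgesIn_univ] at h
    simp only [Finset.univ_inter, hS, hT] at hc
    -- After the first pair the rest lies in S ∪ {u} and T ∪ {u}, which span at most 4s-5 pairs.
    have := hl.edgesIn_add_lt_of_inter_singleton hs hV u (Finset.univ \ T) (Finset.univ \ S)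
      (by
        ext a
        have h1 := sep.cover a
        have h2 := sep.notMem_left
        have h3 := sep.notMem_right
        simp only [Finset.mem_inter, Finset.mem_sdiff, Finset.mem_univ, true_and,
          Finset.mem_singleton]
        constructor
        · tauto
        · rintro rfl; tauto)
      (by
        ext a
        have : a ∈ S → a ∉ T := fun h => Finset.disjoint_left.1 hST h
        simp only [Finset.mem_union, Finset.mem_sdiff, Finset.mem_univ, true_and, iff_true]
        tauto) hc.2.1 hc.2.2
    simp only [List.length_cons]
    omega

end Bound

/-! ### A peelable list with 4s-4 pairs -/

section Construction

variable {V : Type*} [DecidableEq V] [Fintype V] {l : List (Sym2 V)} {S T X Y : Finset V}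
  {u x y : V} {s : ℕ}

/-- The blocks S and T can be padded to size s with unused vertices, since such vertices lie in no
pair of `l` except possibly u, which stays the hinge. -/
theorem Peelable.cons_of_blocks (hV : Fintype.card V = 2 * s + 1) (hl : Peelable s l)
    (hST : Disjoint S T) (huS : u ∉ S) (huT : u ∉ T) (hS : S.card ≤ s) (hT : T.card ≤ s)
    (hsupp : ∀ z ∈ l, z ∈ (insert u S).sym2 ∨ z ∈ (insert u T).sym2) (hx : x ∈ S) (hy : y ∈ T) :
    Peelable s (s(x, y) :: l) := by
  obtain ⟨S', hSS', hS'T, hS'⟩ := Finset.exists_subsuperset_card_eq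
    (s := S) (t := (insert u T)ᶜ) (n := s)
    (fun a ha => by
      simp only [Finset.mem_compl, Finset.mem_insert, not_or]
      exact ⟨fun h => huS (h ▸ ha), Finset.disjoint_left.1 hST ha⟩)
    hS (by rw [Finset.card_compl, hV, Finset.card_insert_of_notMem huT]; omega)
  have huS' : u ∉ S' := fun h => by simpa using hS'T h
  have hT' : ∀ a ∈ T, a ∉ S' := fun a ha h => by
    have := hS'T h
    simp [ha] at this
  refine Peelable.cons S' (insert u S')ᶜ x y hl ?_ hS' ?_ ?_ (hSS' hx) ?_
  · rw [Finset.disjoint_left]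
    intro a ha h
    simp [ha] at h
  · rw [Finset.card_compl, hV, Finset.card_insert_of_notMem huS']; omega
  · intro a ha b hb hab
    rcases hsupp _ hab with h | h
    · rw [Finset.mk_mem_sym2_iff] at h
      exact (Finset.mem_compl.1 hb) (Finset.insert_subset_insert _ hSS' h.2)
    · rw [Finset.mk_mem_sym2_iff] at h
      exact (Finset.mem_compl.1 (hS'T ha)) h.1
  · simp only [Finset.mem_compl, Finset.mem_insert, not_or]
    exact ⟨fun h => huT (h ▸ hy), hT' y hy⟩

/-- Every pair of the peelable list `l` lies inside one of the disjoint sets `X` and `Y`. -/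
structure PeelableOn {V : Type*} [DecidableEq V] (s : ℕ) (l : List (Sym2 V)) (X Y : Finset V) :
    Prop where
  peelable : Peelable s l
  disj : Disjoint X Y
  supp : ∀ z ∈ l, z ∈ X.sym2 ∨ z ∈ Y.sym2

omit [Fintype V] in
theorem PeelableOn.symm (h : PeelableOn s l X Y) : PeelableOn s l Y X :=
  ⟨h.peelable, h.disj.symm, fun z hz => (h.supp z hz).symm⟩

/-- A new vertex z is tied to two vertices a, b of X, which preserves tightness. The pair az uses a
spare vertex w as hinge; then bz uses a, so that az stays on the side of z. -/
theorem PeelableOn.exists_insert (hV : Fintype.card V = 2 * s + 1) (h : PeelableOn s l X Y)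
    (hX2 : 2 ≤ X.card) (hX : X.card ≤ s) (hY : Y.card < s) :
    ∃ (z : V) (l' : List (Sym2 V)), PeelableOn s l' (insert z X) Y ∧ z ∉ X ∧
      l'.length = l.length + 2 := by
  obtain ⟨a, ha, b, hb, hab⟩ := Finset.one_lt_card.1 hX2
  have hcard : 1 < ((X ∪ Y)ᶜ).card := by
    rw [Finset.card_compl, Finset.card_union_of_disjoint h.disj]; omega
  obtain ⟨z, hz, w, hw, hzw⟩ := Finset.one_lt_card.1 hcard
  simp only [Finset.mem_compl, Finset.mem_union, not_or] at hz hw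
  have h1 : Peelable s (s(a, z) :: l) := by
    refine h.peelable.cons_of_blocks hV (u := w) (S := X) (T := insert z Y) ?_ hw.1 ?_ hX ?_ ?_
      ha (Finset.mem_insert_self _ _)
    · rw [Finset.disjoint_insert_right]; exact ⟨hz.1, h.disj⟩
    · simp [hw.2, hzw.symm]
    · exact (Finset.card_insert_le _ _).trans hY
    · intro e he
      refine (h.supp e he).imp (fun h => ?_) fun h => ?_
      · exact Finset.sym2_mono (Finset.subset_insert _ _) h
      · exact Finset.sym2_mono ((Finset.subset_insert _ _).trans (Finset.subset_insert _ _)) h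
  refine ⟨z, s(b, z) :: s(a, z) :: l, ⟨?_, ?_, ?_⟩, hz.1, rfl⟩
  · refine h1.cons_of_blocks hV (u := a) (S := X.erase a) (T := insert z Y) ?_ (by simp) ?_ ?_ ?_ ?_
      (by simp [hb, hab.symm]) (Finset.mem_insert_self _ _)
    · rw [Finset.disjoint_insert_right]
      exact ⟨fun h' => hz.1 (Finset.mem_of_mem_erase h'), h.disj.mono_left (Finset.erase_subset _ _)⟩
    · rw [Finset.mem_insert, not_or]
      exact ⟨fun h' => hz.1 (h' ▸ ha), Finset.disjoint_left.1 h.disj ha⟩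
    · exact (Finset.card_erase_le).trans hX
    · exact (Finset.card_insert_le _ _).trans hY
    · intro e he
      rcases List.mem_cons.1 he with rfl | he
      · right; simp
      refine (h.supp e he).imp (fun h => ?_) fun h => ?_
      · rwa [Finset.insert_erase ha]
      · exact Finset.sym2_mono ((Finset.subset_insert _ _).trans (Finset.subset_insert _ _)) h
  · rw [Finset.disjoint_insert_left]; exact ⟨hz.2, h.disj⟩
  · intro e he
    rcases List.mem_cons.1 he with rfl | he
    · left; simp [hb]
    rcases List.mem_cons.1 he with rfl | he
    · left; simp [ha]
    exact (h.supp e he).imp_left fun h => Finset.sym2_mono (Finset.subset_insert _ _) h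

theorem PeelableOn.exists_card_eq (hV : Fintype.card V = 2 * s + 1) (h : PeelableOn s l X Y)
    (hX2 : 2 ≤ X.card) (hY : Y.card < s) (k : ℕ) (hk : X.card + k ≤ s) :
    ∃ (X' : Finset V) (l' : List (Sym2 V)), PeelableOn s l' X' Y ∧ X'.card = X.card + k ∧
      l'.length = l.length + 2 * k := by
  induction k with
  | zero => exact ⟨X, l, h, rfl, rfl⟩
  | succ k ih =>
    obtain ⟨X', l', h', hc, hl⟩ := ih (by omega)
    obtain ⟨z, l'', h'', hz, hl'⟩ := h'.exists_insert hV (by omega) (by omega) hY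
    exact ⟨_, l'', h'', by rw [Finset.card_insert_of_notMem hz]; omega, by omega⟩

theorem exists_peelableOn (hs : 2 < s) (hV : Fintype.card V = 2 * s + 1) :
    ∃ (X Y : Finset V) (l : List (Sym2 V)), PeelableOn s l X Y ∧ X.card + 1 = s ∧ Y.card = s ∧
      l.length + 8 = 4 * s := by
  obtain ⟨X, -, hX⟩ := Finset.exists_subset_card_eq (s := (Finset.univ : Finset V)) (n := 2)
    (by rw [Finset.card_univ]; omega)
  obtain ⟨Y, hXY, hY⟩ := Finset.exists_subset_card_eq (s := Xᶜ) (n := 2)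
    (by rw [Finset.card_compl]; omega)
  have hd : Disjoint X Y := (Finset.subset_compl_iff_disjoint_left.1 hXY)
  obtain ⟨u, hu⟩ : ((X ∪ Y)ᶜ).Nonempty := by
    rw [← Finset.card_pos, Finset.card_compl, Finset.card_union_of_disjoint hd]; omega
  obtain ⟨a, b, hab, rfl⟩ := Finset.card_eq_two.1 hX
  obtain ⟨c, d, hcd, rfl⟩ := Finset.card_eq_two.1 hY
  simp only [Finset.mem_compl, Finset.mem_union, Finset.mem_insert, Finset.mem_singleton,
    not_or] at hu
  have hd' := hd
  simp only [Finset.disjoint_insert_left, Finset.disjoint_singleton_left, Finset.mem_insert,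
    Finset.mem_singleton, not_or] at hd
  have h1 : Peelable s [s(a, b)] :=
    Peelable.nil.cons_of_blocks hV (u := u) (S := {a}) (T := {b}) (by simpa using hab)
      (by simp [hu]) (by simp [hu]) (by simp; omega) (by simp; omega) (by simp) (by simp) (by simp)
  have h2 : Peelable s [s(c, d), s(a, b)] :=
    h1.cons_of_blocks hV (u := u) (S := {a, b, c}) (T := {d})
      (by simp [Ne.symm hcd, Ne.symm hd.1.2, Ne.symm hd.2.2]) (by simp [hu]) (by simp [hu])
      (Finset.card_le_three.trans hs) (by simp; omega) (by simp) (by simp) (by simp)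
  have h3 : PeelableOn s [s(c, d), s(a, b)] {a, b} {c, d} := ⟨h2, hd', by simp⟩
  -- X stops at s-1 vertices, so that Y can still grow to s with a spare hinge.
  obtain ⟨X, l, h4, hX', hl⟩ := h3.exists_card_eq hV (by omega) (by omega) (s - 3) (by omega)
  obtain ⟨Y, l', h5, hY', hl'⟩ := h4.symm.exists_card_eq hV (by omega) (by omega) (s - 2) (by omega)
  simp only [List.length_cons, List.length_nil] at hl
  exact ⟨X, Y, l', h5.symm, by omega, by omega, by omega⟩

/-- With x and y the vertices outside the blocks P and Q, the pairs qy, px, py, pq go in front in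
this order, with hinges x, q, q, y. -/
theorem exists_peelable_length (hs : 2 < s) (hV : Fintype.card V = 2 * s + 1) :
    ∃ l : List (Sym2 V), Peelable s l ∧ l.length = 4 * s - 4 := by
  obtain ⟨P, Q, l, h, hP, hQ, hl⟩ := exists_peelableOn hs hV
  have hcard : ((P ∪ Q)ᶜ).card = 2 := by
    rw [Finset.card_compl, Finset.card_union_of_disjoint h.disj]; omega
  obtain ⟨x, y, hxy, hc⟩ := Finset.card_eq_two.1 hcard
  have hx : x ∈ (P ∪ Q)ᶜ := by simp [hc]
  have hy : y ∈ (P ∪ Q)ᶜ := by simp [hc]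
  simp only [Finset.mem_compl, Finset.mem_union, not_or] at hx hy
  obtain ⟨p, hp⟩ : P.Nonempty := Finset.card_pos.1 (by omega)
  obtain ⟨q, hq⟩ : Q.Nonempty := Finset.card_pos.1 (by omega)
  have hpQ : p ∉ Q := Finset.disjoint_left.1 h.disj hp
  have hqP : q ∉ P := Finset.disjoint_right.1 h.disj hq
  have hqx : q ≠ x := by rintro rfl; exact hx.2 hq
  have hqy : q ≠ y := by rintro rfl; exact hy.2 hq
  have hcP : ∀ z, z ∉ P → (insert z P).card = s := fun z hz => by
    rw [Finset.card_insert_of_notMem hz, hP]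
  have hdE := h.disj.mono_right (Finset.erase_subset q Q)
  have h1 : Peelable s (s(q, y) :: l) := by
    refine h.peelable.cons_of_blocks hV (u := x) (S := Q) (T := insert y P) ?_ hx.2 ?_ hQ.le
      (hcP y hy.1).le ?_ hq (by simp)
    · rw [Finset.disjoint_insert_right]; exact ⟨hy.2, h.disj.symm⟩
    · simp [hxy, hx]
    · intro e he
      refine (h.supp e he).symm.imp (fun h => ?_) fun h => ?_
      · exact Finset.sym2_mono (Finset.subset_insert _ _) h
      · exact Finset.sym2_mono ((Finset.subset_insert _ _).trans (Finset.subset_insert _ _)) h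
  have h2 : Peelable s (s(p, x) :: s(q, y) :: l) := by
    refine h1.cons_of_blocks hV (u := q) (S := insert y P) (T := insert x (Q.erase q)) ?_ ?_ ?_
      (hcP y hy.1).le ?_ ?_ (by simp [hp]) (by simp)
    · simp only [Finset.disjoint_insert_right, Finset.disjoint_insert_left, Finset.mem_insert,
        Finset.mem_erase, not_or]
      exact ⟨⟨hxy, hx.1⟩, fun h => hy.2 h.2, hdE⟩
    · simp [hqy, hqP]
    · simp [hqx]
    · refine (Finset.card_insert_le _ _).trans ?_
      rw [Finset.card_erase_of_mem hq]; omega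
    · intro e he
      rcases List.mem_cons.1 he with rfl | he
      · left; simp
      refine (h.supp e he).imp (fun h => ?_) fun h => ?_
      · exact Finset.sym2_mono ((Finset.subset_insert _ _).trans (Finset.subset_insert _ _)) h
      · refine Finset.sym2_mono ?_ h
        rw [Finset.insert_comm, Finset.insert_erase hq]
        exact Finset.subset_insert _ _
  have h2s : ∀ e ∈ s(p, x) :: s(q, y) :: l, e ∈ (insert x P).sym2 ∨ e ∈ (insert y Q).sym2 := by
    intro e he
    rcases List.mem_cons.1 he with rfl | he
    · left; simp [hp]
    rcases List.mem_cons.1 he with rfl | he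
    · right; simp [hq]
    exact (h.supp e he).imp (fun h => Finset.sym2_mono (Finset.subset_insert _ _) h)
      fun h => Finset.sym2_mono (Finset.subset_insert _ _) h
  have h3 : Peelable s (s(p, y) :: s(p, x) :: s(q, y) :: l) := by
    refine h2.cons_of_blocks hV (u := q) (S := insert x P) (T := insert y (Q.erase q)) ?_ ?_ ?_
      (hcP x hx.1).le ?_ ?_ (by simp [hp]) (by simp)
    · simp only [Finset.disjoint_insert_right, Finset.disjoint_insert_left, Finset.mem_insert,
        Finset.mem_erase, not_or]
      exact ⟨⟨hxy.symm, hy.1⟩, fun h => hx.2 h.2, hdE⟩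
    · simp [hqx, hqP]
    · simp [hqy]
    · refine (Finset.card_insert_le _ _).trans ?_
      rw [Finset.card_erase_of_mem hq]; omega
    · intro e he
      refine (h2s e he).imp (fun h => ?_) fun h => ?_
      · exact Finset.sym2_mono (Finset.subset_insert _ _) h
      · rwa [Finset.insert_comm, Finset.insert_erase hq]
  refine ⟨s(p, q) :: s(p, y) :: s(p, x) :: s(q, y) :: l, ?_, by simp only [List.length_cons]; omega⟩
  refine h3.cons_of_blocks hV (u := y) (S := insert x P) (T := Q) ?_ ?_ hy.2
      (hcP x hx.1).le hQ.le ?_ (by simp [hp]) hq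
  · rw [Finset.disjoint_insert_left]; exact ⟨hx.2, h.disj⟩
  · simp [hxy.symm, hy]
  · intro e he
    rcases List.mem_cons.1 he with rfl | he
    · left; simp [hp]
    refine (h2s e he).imp_left fun h => ?_
    exact Finset.sym2_mono (Finset.subset_insert _ _) h

end Construction

/-! ### Weakly saturated graphs and peelable lists -/

section Saturation

variable {V : Type*} [DecidableEq V] {l : List (Sym2 V)} {s : ℕ}

omit [DecidableEq V] in
theorem exists_copy_mem_edgeSet_iff {H : SimpleGraph V} {z : Sym2 V} :
    (∃ f : SimpleGraph.Copy (completeBipartiteGraph (Fin s) (Fin s)) H,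
      z ∈ f.toSubgraph.edgeSet) ↔
    ∃ S T : Finset V, S.card = s ∧ T.card = s ∧ (∀ a ∈ S, ∀ b ∈ T, H.Adj a b) ∧
      ∃ x ∈ S, ∃ y ∈ T, z = s(x, y) := by
  constructor
  · rintro ⟨f, hf⟩
    refine ⟨Finset.univ.map ⟨f ∘ Sum.inl, f.injective.comp Sum.inl_injective⟩,
      Finset.univ.map ⟨f ∘ Sum.inr, f.injective.comp Sum.inr_injective⟩, by simp, by simp, ?_, ?_⟩
    · intro a ha b hb
      rw [Finset.mem_map] at ha hb
      obtain ⟨i, -, rfl⟩ := ha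
      obtain ⟨j, -, rfl⟩ := hb
      exact f.toHom.map_adj (by simp)
    · induction z using Sym2.ind with
      | _ p q =>
        rw [SimpleGraph.Subgraph.mem_edgeSet, SimpleGraph.Subgraph.map_adj] at hf
        obtain ⟨i, j, hij, rfl, rfl⟩ := hf
        rcases i with i | i <;> rcases j with j | j <;> simp at hij
        · exact ⟨f (Sum.inl i), by simp, f (Sum.inr j), by simp, rfl⟩
        · exact ⟨f (Sum.inl j), by simp, f (Sum.inr i), by simp, Sym2.eq_swap⟩
  · rintro ⟨S, T, hS, hT, h, x, hx, y, hy, rfl⟩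
    have hne : ∀ a ∈ S, ∀ b ∈ T, a ≠ b := fun a ha b hb => (h a ha b hb).ne
    let e₁ := S.equivFinOfCardEq hS
    let e₂ := T.equivFinOfCardEq hT
    let f : Fin s ⊕ Fin s → V := Sum.elim (fun i => (e₁.symm i : V)) fun i => (e₂.symm i : V)
    refine ⟨⟨⟨f, ?_⟩, ?_⟩, ?_⟩
    · rintro (i | i) (j | j) hij <;> simp at hij
      · exact h _ (e₁.symm i).2 _ (e₂.symm j).2
      · exact (h _ (e₁.symm j).2 _ (e₂.symm i).2).symm
    · rintro (i | i) (j | j) hij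
      · have : e₁.symm i = e₁.symm j := Subtype.ext hij
        rw [e₁.symm.injective this]
      · exact absurd hij (hne _ (e₁.symm i).2 _ (e₂.symm j).2)
      · exact absurd hij.symm (hne _ (e₁.symm j).2 _ (e₂.symm i).2)
      · have : e₂.symm i = e₂.symm j := Subtype.ext hij
        rw [e₂.symm.injective this]
    · rw [SimpleGraph.Subgraph.mem_edgeSet, SimpleGraph.Subgraph.map_adj]
      exact ⟨Sum.inl (e₁ ⟨x, hx⟩), Sum.inr (e₂ ⟨y, hy⟩), by simp, by simp [f], by simp [f]⟩

theorem peelable_of_forall (h : ∀ (i : ℕ) (hi : i < l.length), ∃ S T : Finset V,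
    Disjoint S T ∧ S.card = s ∧ T.card = s ∧ (∃ x ∈ S, ∃ y ∈ T, l[i] = s(x, y)) ∧
      ∀ a ∈ S, ∀ b ∈ T, ∀ (j : ℕ) (hj : j < l.length), i < j → l[j] ≠ s(a, b)) :
    Peelable s l := by
  induction l with
  | nil => exact Peelable.nil
  | cons z l ih =>
    obtain ⟨S, T, hST, hS, hT, ⟨x, hx, y, hy, hz⟩, hcross⟩ := h 0 (by simp)
    simp only [List.getElem_cons_zero] at hz
    subst hz
    refine Peelable.cons S T x y (ih fun i hi => ?_) hST hS hT ?_ hx hy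
    · obtain ⟨S, T, hST, hS, hT, hz, hcross⟩ := h (i + 1) (by simpa using hi)
      refine ⟨S, T, hST, hS, hT, by simpa using hz, fun a ha b hb j hj hij => ?_⟩
      exact hcross a ha b hb (j + 1) (by simpa using hj) (by omega)
    · intro a ha b hb hab
      obtain ⟨j, hj, hjz⟩ := List.mem_iff_getElem.1 hab
      exact hcross a ha b hb (j + 1) (by simpa using hj) (by omega) (by simpa using hjz)

theorem Peelable.exists_getElem (hl : Peelable s l) (i : ℕ) (hi : i < l.length) :
    ∃ S T : Finset V,
    Disjoint S T ∧ S.card = s ∧ T.card = s ∧ (∃ x ∈ S, ∃ y ∈ T, l[i] = s(x, y)) ∧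
      ∀ a ∈ S, ∀ b ∈ T, ∀ (j : ℕ) (hj : j < l.length), i < j → l[j] ≠ s(a, b) := by
  induction hl generalizing i with
  | nil => simp at hi
  | @cons l S T x y hl hST hS hT hcross hx hy ih =>
    cases i with
    | zero =>
      refine ⟨S, T, hST, hS, hT, ⟨x, hx, y, hy, rfl⟩, fun a ha b hb j hj hij hz => ?_⟩
      obtain ⟨j, rfl⟩ := Nat.exists_eq_succ_of_ne_zero hij.ne'
      simp only [Nat.succ_eq_add_one, List.getElem_cons_succ] at hz
      exact hcross a ha b hb (hz ▸ List.getElem_mem _)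
    | succ i =>
      obtain ⟨S, T, hST, hS, hT, hz, hcross⟩ := ih i (by simpa using hi)
      refine ⟨S, T, hST, hS, hT, by simpa using hz, fun a ha b hb j hj hij => ?_⟩
      obtain ⟨j, rfl⟩ := Nat.exists_eq_succ_of_ne_zero (show j ≠ 0 by omega)
      simpa using hcross a ha b hb j (by simpa using hj) (by omega)

theorem Peelable.nodup (hl : Peelable s l) : l.Nodup := by
  induction hl with
  | nil => exact List.nodup_nil
  | @cons l S T x y hl hST hS hT hcross hx hy ih =>
    exact List.nodup_cons.2 ⟨hcross x hx y hy, ih⟩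

theorem Peelable.not_isDiag (hl : Peelable s l) : ∀ z ∈ l, ¬z.IsDiag := by
  induction hl with
  | nil => simp
  | @cons l S T x y hl hST hS hT hcross hx hy ih =>
    intro z hz
    rcases List.mem_cons.1 hz with rfl | hz
    · rw [Sym2.mk_isDiag_iff]
      rintro rfl
      exact Finset.disjoint_left.1 hST hx hy
    · exact ih z hz

omit [DecidableEq V] in
theorem ncard_edgeSet_add_ncard_edgeSet_compl [Fintype V] (G : SimpleGraph V) :
    G.edgeSet.ncard + Gᶜ.edgeSet.ncard = (Fintype.card V).choose 2 := by
  classical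
  rw [← Set.ncard_union_eq (SimpleGraph.disjoint_edgeSet.2 disjoint_compl_right)
    (Set.toFinite _) (Set.toFinite _), ← SimpleGraph.edgeSet_sup, sup_compl_eq_top,
    ← SimpleGraph.card_edgeFinset_top_eq_card_choose_two, ← SimpleGraph.coe_edgeFinset,
    Set.ncard_coe_finset]

theorem IsWeaklySaturated.exists_peelable {G : SimpleGraph V}
    (h : IsWeaklySaturated (completeBipartiteGraph (Fin s) (Fin s)) G) :
    ∃ l : List (Sym2 V), Peelable s l ∧ l.length = Gᶜ.edgeSet.ncard := by
  obtain ⟨-, m, e, he, hrange, hcopy⟩ := h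
  refine ⟨List.ofFn e, peelable_of_forall fun i hi => ?_, ?_⟩
  · rw [List.length_ofFn] at hi
    obtain ⟨S, T, hS, hT, hadj, x, hx, y, hy, hz⟩ :=
      exists_copy_mem_edgeSet_iff.1 (hcopy ⟨i, hi⟩)
    refine ⟨S, T, ?_, hS, hT, ⟨x, hx, y, hy, by simpa using hz⟩, ?_⟩
    · rw [Finset.disjoint_left]
      exact fun a ha hb => (hadj a ha a hb).ne rfl
    · intro a ha b hb j hj hij hjz
      rw [List.length_ofFn] at hj
      rw [List.getElem_ofFn] at hjz
      have hmem : s(a, b) ∈ Gᶜ.edgeSet := hrange ▸ ⟨_, hjz⟩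
      rw [SimpleGraph.mem_edgeSet, SimpleGraph.compl_adj] at hmem
      rcases hadj a ha b hb with h | h
      · exact hmem.2 h
      · rw [SimpleGraph.fromEdgeSet_adj] at h
        obtain ⟨⟨k, hk, hkz⟩, -⟩ := h
        have := he (hkz.trans hjz.symm)
        subst this
        exact absurd hk (by simpa using hij)
  · rw [List.length_ofFn, ← hrange, ← Set.image_univ, Set.ncard_image_of_injective _ he,
      Set.ncard_univ, Nat.card_fin]

theorem Peelable.isWeaklySaturated (hl : Peelable s l) (hs : 0 < s)
    (hmax : ∀ l' : List (Sym2 V), Peelable s l' → l'.length ≤ l.length) :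
    IsWeaklySaturated (completeBipartiteGraph (Fin s) (Fin s))
        (SimpleGraph.fromEdgeSet {z | z ∈ l})ᶜ ∧
      (SimpleGraph.fromEdgeSet {z | z ∈ l})ᶜᶜ.edgeSet.ncard = l.length := by
  have hedge : (SimpleGraph.fromEdgeSet {z | z ∈ l})ᶜᶜ.edgeSet = {z | z ∈ l} := by
    rw [compl_compl, SimpleGraph.edgeSet_fromEdgeSet]
    ext z
    simpa using hl.not_isDiag z
  have hinj : Function.Injective l.get := List.nodup_iff_injective_get.1 hl.nodup
  have hrange : Set.range l.get = {z | z ∈ l} := Set.range_list_get l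
  refine ⟨⟨?_, l.length, l.get, hinj, by rw [hrange, hedge], ?_⟩, ?_⟩
  · rw [SimpleGraph.Free, SimpleGraph.completeBipartiteGraph_isContained_iff]
    rintro ⟨S, T, hS, hT, hadj⟩
    rw [Fintype.card_fin] at hS hT
    obtain ⟨x, hx⟩ := Finset.card_pos.1 (hS.symm ▸ hs)
    obtain ⟨y, hy⟩ := Finset.card_pos.1 (hT.symm ▸ hs)
    -- A copy of K_{s,s} in the complement would give a longer peelable list, against maximality.
    have := hmax _ (Peelable.cons S T x y hl (Finset.disjoint_coe.1 hadj.disjoint) hS hT ?_ hx hy)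
    · simp at this
    · intro a ha b hb hab
      have h := hadj ha hb
      rw [SimpleGraph.compl_adj, SimpleGraph.fromEdgeSet_adj] at h
      exact h.2 ⟨hab, h.1⟩
  · intro i
    rw [exists_copy_mem_edgeSet_iff]
    obtain ⟨S, T, hST, hS, hT, ⟨x, hx, y, hy, hz⟩, hcross⟩ := hl.exists_getElem i i.2
    refine ⟨S, T, hS, hT, fun a ha b hb => ?_, x, hx, y, hy, by simpa using hz⟩
    have hab : a ≠ b := by rintro rfl; exact Finset.disjoint_left.1 hST ha hb
    rw [SimpleGraph.sup_adj, SimpleGraph.compl_adj, SimpleGraph.fromEdgeSet_adj,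
      SimpleGraph.fromEdgeSet_adj]
    by_cases hmem : s(a, b) ∈ l
    · right
      refine ⟨?_, hab⟩
      obtain ⟨j, hj, hjz⟩ := List.mem_iff_getElem.1 hmem
      refine ⟨⟨j, hj⟩, ?_, by simpa using hjz⟩
      by_contra hlt
      exact hcross a ha b hb j hj (by simpa [Fin.lt_def] using hlt) hjz
    · left
      exact ⟨hab, fun h => hmem h.1⟩
  · rw [hedge, ← hrange, ← Set.image_univ, Set.ncard_image_of_injective _ hinj,
      Set.ncard_univ, Nat.card_fin]

end Saturation

/-! ### The weak saturation number -/

theorem theorem1 (s : ℕ) (hs : 2 < s) :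
    (∃ G : SimpleGraph (Fin (2 * s + 1)),
      IsWeaklySaturated (completeBipartiteGraph (Fin s) (Fin s)) G) ∧
    (wsat (2 * s + 1) (completeBipartiteGraph (Fin s) (Fin s)) : ℤ) =
      ((2 * s + 1).choose 2 : ℤ) - (4 * (s : ℤ) - 4) := by
  have hV : Fintype.card (Fin (2 * s + 1)) = 2 * s + 1 := Fintype.card_fin _
  obtain ⟨l, hl, hlen⟩ := exists_peelable_length hs hV
  obtain ⟨hG, hcard⟩ := hl.isWeaklySaturated (by omega) fun l' hl' => by
    rw [hlen]; exact hl'.length_le hs hV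
  refine ⟨⟨_, hG⟩, ?_⟩
  have hle : wsat (2 * s + 1) (completeBipartiteGraph (Fin s) (Fin s)) ≤ _ :=
    Nat.sInf_le ⟨_, hG, rfl⟩
  obtain ⟨G', hG', hcard'⟩ :
      wsat (2 * s + 1) (completeBipartiteGraph (Fin s) (Fin s)) ∈ _ :=
    Nat.sInf_mem ⟨_, _, hG, rfl⟩
  obtain ⟨l', hl', hlen'⟩ := hG'.exists_peelable
  have h1 := hl'.length_le hs hV
  have h2 := ncard_edgeSet_add_ncard_edgeSet_compl G'
  have h3 := ncard_edgeSet_add_ncard_edgeSet_compl (SimpleGraph.fromEdgeSet {z | z ∈ l})ᶜ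
  rw [Fintype.card_fin] at h2 h3
  omega
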